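/- Let $n\ge 0$, $N=\binom n2$, and let $S=\mathbf j_1\cdots\mathbf j_N$ be a sorting network on $n$ strands: a word of length $N$ in the elementary transpositions $\mathbf j=(j,j+1)$, $1\le j\le n-1$, of the symmetric group $\mathfrak S_n$, whose product is the long element $x\mapsto n+1-x$. A signature is a vector $\sigma\in\{\pm1\}^N$. Write $\mathbf j$ also for the $j$-th standard generator of Artin's braid group $B_n$; the algebraic sorting braid of $(S,\sigma)$ is $$\mathfrak A(S,\sigma)=\mathbf j_1^{\sigma_1}\cdots\mathbf j_N^{\sigma_N}\,(\mathbf{n-j}_1)^{-\sigma_1}\cdots(\mathbf{n-j}_N)^{-\sigma_N}\in B_n .$$ It is trivial if it is the identity of $B_n$. The $k$-th letter of $S$ swaps the particles at positions $j_k$ and $j_k+1$; this is the crossing of these two particles in the wiring diagram of $S$ (particle $i$ starts at position $i$). For $p\in\mathfrak S_n$ and $i<j$ put $\mathsf{inv}(p)_{i,j}=+1$ if $p(i)>p(j)$ and $-1$ if $p(i)<p(j)$. We say that $\sigma$ is the inversion set of $p$ if, for all $i<j$, the sign of $\sigma$ at each crossing of the particles $i$ and $j$ in $S$ is $\mathsf{inv}(p)_{i,j}$,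 and that $\sigma$ comes from a strict total order $\succ$ on $\{1,\dots,n\}$ if, for all $i<j$, the sign at each such crossing is $+1$ exactly when $i\succ j$. **Theorem.** Out of all $2^N$ signatures $\sigma$ of $S$, exactly $n!$ provide a trivial algebraic sorting braid $\mathfrak A(S,\sigma)$. These are exactly the signatures that are the inversion set of some permutation $p\in\mathfrak S_n$; equivalently, the signatures that come from a total order on the strands. The same count and the same characterization hold if "$\mathfrak A(S,\sigma)$ is trivial" is replaced by "the closure of $\mathfrak A(S,\sigma)$ is a trivial link of $n$ components", where links are compared through braids: two braids have isotopic closures if they are related by a finite sequence of Markov moves (conjugation, positive and negative stabilization) and their inverses. -/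

import Mathlib

/-! ### Sorting networks

Everything is indexed from `0`: the `n` strands (and the `n` positions) are the elements of
`Fin n`, and the letter `i : Fin (n - 1)` of a word stands for the letter `i + 1` among
`1, …, n - 1`. -/

namespace SortingBraid

/-- The elementary transposition exchanging `i` and `i + 1`. -/
def adjSwap {n : ℕ} (i : Fin (n - 1)) : Equiv.Perm (Fin n) :=
  Equiv.swap ⟨i, by omega⟩ ⟨i + 1, by omega⟩

/-- A sorting network on `n` elements: a word of length `n.choose 2` in the elementary
transpositions whose product is the long element `x ↦ n - 1 - x`. -/
structure SortingNetwork (n : ℕ) where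
  /-- The letters, in the order in which the swaps are performed. -/
  word : Fin (n.choose 2) → Fin (n - 1)
  prod_word : (List.ofFn fun k => adjSwap (word k)).prod = Fin.revPerm

/-- A signature: a sign for every letter of a sorting network. -/
abbrev Signature (n : ℕ) : Type := Fin (n.choose 2) → ℤˣ

namespace SortingNetwork

variable {n : ℕ}

/-- The configuration after the first `k` swaps. Since `Equiv.Perm` composes from right to left,
`S.configuration k x` is the particle which is at position `x` after the first `k` swaps. -/
def configuration (S : SortingNetwork n) (k : ℕ) : Equiv.Perm (Fin n) :=
  ((List.ofFn fun l => adjSwap (S.word l)).take k).prod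

/-- The particle that is at the left position of the `k`-th swap just before it happens. -/
def leftParticle (S : SortingNetwork n) (k : Fin (n.choose 2)) : Fin n :=
  S.configuration k ⟨S.word k, by have := (S.word k).isLt; omega⟩

/-- The particle that is at the right position of the `k`-th swap just before it happens. -/
def rightParticle (S : SortingNetwork n) (k : Fin (n.choose 2)) : Fin n :=
  S.configuration k ⟨S.word k + 1, by have := (S.word k).isLt; omega⟩

/-- The `k`-th swap of the network is a crossing of the trajectories of the particles
`i` and `j` (in either order). -/
def Crosses (S : SortingNetwork n) (k : Fin (n.choose 2)) (i j : Fin n) : Prop :=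
  s(S.leftParticle k, S.rightParticle k) = s(i, j)

end SortingNetwork

/-- The inversion set of a permutation, as a vector of signs. -/
def inv {n : ℕ} (p : Equiv.Perm (Fin n)) (i j : Fin n) : ℤˣ :=
  if p j < p i then 1 else -1

/-- The signature `σ` of `S` is the inversion set of `p`: the sign at the crossing of the
particles `i < j` is `inv p i j`. -/
def IsInversionSet {n : ℕ} (S : SortingNetwork n) (σ : Signature n)
    (p : Equiv.Perm (Fin n)) : Prop :=
  ∀ i j : Fin n, i < j → ∀ k, S.Crosses k i j → σ k = inv p i j

/-- The signature `σ` of `S` is read off from the relation `r` on the strands (`r i j` meaning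
that `i` is greater than `j`): the sign at the crossing of `i < j` is `+` exactly when `r i j`. -/
def ComesFromOrder {n : ℕ} (S : SortingNetwork n) (σ : Signature n)
    (r : Fin n → Fin n → Prop) : Prop :=
  ∀ i j : Fin n, i < j → ∀ k, S.Crosses k i j → (σ k = 1 ↔ r i j)

/-! ### Braids -/

/-- The defining relators of the braid group on `n` strands: `i j = j i` if `|i - j| ≥ 2` and
`i j i = j i j` if `|i - j| = 1`. -/
def braidRels (n : ℕ) : Set (FreeGroup (Fin (n - 1))) :=
  {w | ∃ i j : Fin (n - 1), (i : ℕ) + 2 ≤ j ∧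
      w = FreeGroup.of i * FreeGroup.of j * (FreeGroup.of j * FreeGroup.of i)⁻¹} ∪
  {w | ∃ i j : Fin (n - 1), (i : ℕ) + 1 = j ∧
      w = FreeGroup.of i * FreeGroup.of j * FreeGroup.of i *
        (FreeGroup.of j * FreeGroup.of i * FreeGroup.of j)⁻¹}

/-- Artin's braid group on `n` strands. -/
abbrev BraidGroup (n : ℕ) : Type := PresentedGroup (braidRels n)

/-- The standard generator of the braid group: a positive crossing at positions `i`, `i + 1`. -/
def gen {n : ℕ} (i : Fin (n - 1)) : BraidGroup n := PresentedGroup.of i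

/-- The algebraic sorting braid
`j₁ ^ σ₁ ⋯ j_N ^ σ_N (n - j₁) ^ (-σ₁) ⋯ (n - j_N) ^ (-σ_N)`.
With letters indexed from `0`, the letter `n - j` is `Fin.rev j`. -/
def algebraicSortingBraid {n : ℕ} (S : SortingNetwork n) (σ : Signature n) : BraidGroup n :=
  (List.ofFn fun k => gen (S.word k) ^ (σ k : ℤ)).prod *
    (List.ofFn fun k => gen (S.word k).rev ^ (-(σ k : ℤ))).prod

/-! ### Closures of braids -/

theorem addStrand_aux (n : ℕ) : ∀ w ∈ braidRels n,
    FreeGroup.lift (fun i : Fin (n - 1) =>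
      (gen (i.castLE (by omega)) : BraidGroup (n + 1))) w = 1 := by
  rintro w (⟨i, j, hij, rfl⟩ | ⟨i, j, hij, rfl⟩)
  · exact PresentedGroup.one_of_mem (rels := braidRels (n + 1))
      (Or.inl ⟨i.castLE (by omega), j.castLE (by omega), by simpa using hij, rfl⟩)
  · exact PresentedGroup.one_of_mem (rels := braidRels (n + 1))
      (Or.inr ⟨i.castLE (by omega), j.castLE (by omega), by simpa using hij, rfl⟩)

/-- The inclusion of the braid group on `n` strands into the one on `n + 1` strands, adding an
uncrossed last strand. -/
def addStrand (n : ℕ) : BraidGroup n →* BraidGroup (n + 1) :=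
  PresentedGroup.toGroup (addStrand_aux n)

/-- The Markov moves on braids with any number of strands: conjugation, and stabilization by
a new last strand that crosses the previous one once. -/
inductive MarkovMove : (Σ n, BraidGroup n) → (Σ n, BraidGroup n) → Prop
  | conj {n : ℕ} (a b : BraidGroup n) : MarkovMove ⟨n, b⟩ ⟨n, a * b * a⁻¹⟩
  | stab_pos {n : ℕ} (b : BraidGroup (n + 1)) :
      MarkovMove ⟨n + 1, b⟩ ⟨n + 2, addStrand (n + 1) b * gen (Fin.last n)⟩
  | stab_neg {n : ℕ} (b : BraidGroup (n + 1)) :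
      MarkovMove ⟨n + 1, b⟩ ⟨n + 2, addStrand (n + 1) b * (gen (Fin.last n))⁻¹⟩

/-- Two braids have isotopic closures; isotopy of closed braids is the equivalence relation
generated by the Markov moves. -/
def IsotopicClosures {m n : ℕ} (a : BraidGroup m) (b : BraidGroup n) : Prop :=
  Relation.EqvGen MarkovMove ⟨m, a⟩ ⟨n, b⟩

/-- The closure of the braid `b` on `n` strands is the trivial link: it is isotopic to the
closure of `n` straight strands, that is, to `n` unlinked unknotted circles. -/
def HasTrivialClosure {n : ℕ} (b : BraidGroup n) : Prop :=
  IsotopicClosures b (1 : BraidGroup n)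

end SortingBraid

namespace SortingBraid

/-! ### Crossings of a sorting network -/

/-! Every two strands cross exactly once: they must cross in order to be reversed, and there are as
many letters as pairs. A signature is therefore a tournament on the strands, and the inversion sets
are the transitive tournaments, one for each of the `n!` permutations.

Inversion sets give trivial braids. When `u` is multiplied by an adjacent transposition,
`positiveLift u` is multiplied by the generator at an ascent and by its inverse at a descent. If `σ`
is the inversion set of `p`, these exponents along `S`, starting from `u = revPerm * p`, are exactly
`σ`. The first half of the braid is then a quotient of two lifts; the mirrored half leads back to
`u` and is the inverse quotient (`algebraicSortingBraid_eq_one`).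

Conversely, the number of `G`-tuples fixed by the Hurwitz action is a Markov invariant. For finite
`G` and a trivial closure it is `|G| ^ n`, so the braid acts as the identity. Labelling all strands
but three by `1` erases them from the computation. On a cyclic triple what remains is `(a ^ ε * b ^
(-ε)) ^ 3`, with `a`, `b` the generators of the 3-strand braid group: its closure is the Borromean
rings, and labels in `𝔖₃` show that it acts nontrivially (`eq_of_hasTrivialClosure`). So no triple
is cyclic, and the tournament is a total order. A trivial braid has a trivial closure, so both
characterizations follow. -/

theorem ofFn_take_succ_prod {M : Type*} [Monoid M] {N : ℕ} (f : Fin N → M) (k : Fin N) :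
    ((List.ofFn f).take (k + 1)).prod = ((List.ofFn f).take k).prod * f k := by
  rw [List.prod_take_succ _ _ (by simp)]
  simp

theorem ofFn_take_prod {M : Type*} [Monoid M] {N : ℕ} (f : Fin N → M) :
    ((List.ofFn f).take N).prod = (List.ofFn f).prod := by
  rw [List.take_of_length_le (by simp)]

theorem adjSwap_left {n : ℕ} (i : Fin (n - 1)) :
    adjSwap i ⟨i, by omega⟩ = (⟨i + 1, by omega⟩ : Fin n) := by
  simp [adjSwap]

theorem adjSwap_right {n : ℕ} (i : Fin (n - 1)) :
    adjSwap i ⟨i + 1, by omega⟩ = (⟨i, by omega⟩ : Fin n) := by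
  simp [adjSwap]

theorem adjSwap_of_ne {n : ℕ} (i : Fin (n - 1)) {x : Fin n} (h₀ : (x : ℕ) ≠ i)
    (h₁ : (x : ℕ) ≠ i + 1) : adjSwap i x = x :=
  Equiv.swap_apply_of_ne_of_ne (fun h => h₀ (by simp [h])) (fun h => h₁ (by simp [h]))

theorem adjSwap_val {n : ℕ} (i : Fin (n - 1)) (x : Fin n) :
    (adjSwap i x : ℕ) = if (x : ℕ) = i then (i : ℕ) + 1 else if (x : ℕ) = i + 1 then (i : ℕ)
      else x := by
  by_cases h : (x : ℕ) = i
  · rw [show x = ⟨i, by omega⟩ from Fin.ext h, adjSwap_left]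
    simp
  by_cases h' : (x : ℕ) = i + 1
  · rw [show x = ⟨i + 1, by omega⟩ from Fin.ext h', adjSwap_right]
    simp
  simp [adjSwap_of_ne i h h', h, h']

@[simp]
theorem adjSwap_mul_self {n : ℕ} (i : Fin (n - 1)) : adjSwap i * adjSwap i = 1 :=
  Equiv.swap_mul_self _ _

@[simp]
theorem adjSwap_inv {n : ℕ} (i : Fin (n - 1)) : (adjSwap i)⁻¹ = adjSwap i :=
  Equiv.swap_inv _ _

theorem adjSwap_lt_adjSwap {n : ℕ} (i : Fin (n - 1)) {x y : Fin n} (h : x < y)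
    (hi : ¬((x : ℕ) = i ∧ (y : ℕ) = i + 1)) : adjSwap i x < adjSwap i y := by
  rw [Fin.lt_def] at h ⊢
  rw [adjSwap_val, adjSwap_val]
  split_ifs <;> omega

namespace SortingNetwork

variable {n : ℕ} (S : SortingNetwork n)

/-- The position of the particle `i` after the first `k` swaps. -/
def position (k : ℕ) (i : Fin n) : Fin n := (S.configuration k)⁻¹ i

theorem configuration_zero : S.configuration 0 = 1 := by simp [configuration]

theorem configuration_end : S.configuration (n.choose 2) = Fin.revPerm := by
  rw [configuration, ofFn_take_prod, S.prod_word]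

theorem configuration_succ (k : Fin (n.choose 2)) :
    S.configuration (k + 1) = S.configuration k * adjSwap (S.word k) := by
  rw [configuration, configuration, ofFn_take_succ_prod]

theorem position_injective (k : ℕ) : Function.Injective (S.position k) :=
  (S.configuration k)⁻¹.injective

theorem position_zero (i : Fin n) : S.position 0 i = i := by simp [position, configuration_zero]

theorem position_end (i : Fin n) : S.position (n.choose 2) i = i.rev := by
  simp [position, configuration_end, Equiv.Perm.inv_def]

theorem position_succ (k : Fin (n.choose 2)) (i : Fin n) :
    S.position (k + 1) i = adjSwap (S.word k) (S.position k i) := by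
  rw [position, configuration_succ, mul_inv_rev, adjSwap_inv]
  rfl

theorem position_leftParticle (k : Fin (n.choose 2)) :
    (S.position k (S.leftParticle k) : ℕ) = S.word k := by
  simp [position, leftParticle]

theorem position_rightParticle (k : Fin (n.choose 2)) :
    (S.position k (S.rightParticle k) : ℕ) = S.word k + 1 := by
  simp [position, rightParticle]

theorem leftParticle_ne_rightParticle (k : Fin (n.choose 2)) :
    S.leftParticle k ≠ S.rightParticle k := by
  intro h
  have h₀ := S.position_leftParticle k
  have h₁ := S.position_rightParticle k
  rw [h] at h₀
  omega

theorem eq_leftParticle_iff (k : Fin (n.choose 2)) (i : Fin n) :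
    i = S.leftParticle k ↔ (S.position k i : ℕ) = S.word k := by
  refine ⟨?_, fun h => S.position_injective k (Fin.ext ?_)⟩
  · rintro rfl
    exact S.position_leftParticle k
  · rw [h, position_leftParticle]

theorem eq_rightParticle_iff (k : Fin (n.choose 2)) (i : Fin n) :
    i = S.rightParticle k ↔ (S.position k i : ℕ) = S.word k + 1 := by
  refine ⟨?_, fun h => S.position_injective k (Fin.ext ?_)⟩
  · rintro rfl
    exact S.position_rightParticle k
  · rw [h, position_rightParticle]

variable {S}

theorem Crosses.symm {k : Fin (n.choose 2)} {i j : Fin n} (h : S.Crosses k i j) :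
    S.Crosses k j i := by
  rw [Crosses] at h ⊢
  rw [h, Sym2.eq_swap]

theorem crosses_iff {k : Fin (n.choose 2)} {i j : Fin n} :
    S.Crosses k i j ↔ S.leftParticle k = i ∧ S.rightParticle k = j ∨
      S.leftParticle k = j ∧ S.rightParticle k = i := by
  rw [Crosses, Sym2.eq_iff]

theorem position_lt_of_not_crosses {k : Fin (n.choose 2)} {i j : Fin n} (h : ¬S.Crosses k i j)
    (hij : S.position k i < S.position k j) : S.position (k + 1) i < S.position (k + 1) j := by
  rw [position_succ, position_succ]
  refine adjSwap_lt_adjSwap _ hij fun hk => h ?_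
  rw [crosses_iff]
  exact Or.inl ⟨((S.eq_leftParticle_iff k i).2 hk.1).symm,
    ((S.eq_rightParticle_iff k j).2 hk.2).symm⟩

theorem position_lt_of_forall_not_crosses {i j : Fin n} {k l : ℕ} (hkl : k ≤ l)
    (hl : l ≤ n.choose 2)
    (h : ∀ t : Fin (n.choose 2), k ≤ t → (t : ℕ) < l → ¬S.Crosses t i j)
    (hij : S.position k i < S.position k j) : S.position l i < S.position l j := by
  induction l, hkl using Nat.le_induction with
  | base => exact hij
  | succ l hkl ih =>
    exact position_lt_of_not_crosses (k := ⟨l, hl⟩) (h ⟨l, hl⟩ hkl (by simp))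
      (ih (by omega) fun t h₀ h₁ => h t h₀ (by omega))

/-- Strands that never cross keep their order, but the long element reverses it. -/
theorem exists_crosses {i j : Fin n} (hij : i ≠ j) : ∃ k, S.Crosses k i j := by
  wlog h : i < j generalizing i j
  · obtain ⟨k, hk⟩ := this hij.symm (lt_of_le_of_ne (not_lt.1 h) hij.symm)
    exact ⟨k, hk.symm⟩
  by_contra! hk
  have := position_lt_of_forall_not_crosses (S := S) (Nat.zero_le _) le_rfl
    (fun t _ _ => hk t) (by simpa [position_zero] using h)
  rw [position_end, position_end, Fin.rev_lt_rev] at this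
  exact lt_asymm h this

/-- Sending a letter to the pair it swaps is a surjection between sets of the same size `n.choose
2`, hence a bijection. -/
theorem Crosses.unique {k l : Fin (n.choose 2)} {i j : Fin n} (hk : S.Crosses k i j)
    (hl : S.Crosses l i j) : k = l := by
  let f : Fin (n.choose 2) → {e : Sym2 (Fin n) // ¬e.IsDiag} := fun k =>
    ⟨s(S.leftParticle k, S.rightParticle k), by
      simpa using S.leftParticle_ne_rightParticle k⟩
  have hf : Function.Surjective f := by
    rintro ⟨e, he⟩
    induction e using Sym2.ind with
    | _ i j =>
      obtain ⟨k, hk⟩ := exists_crosses (S := S) (i := i) (j := j) (by simpa using he)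
      exact ⟨k, Subtype.ext hk⟩
  have hb := (Fintype.bijective_iff_surjective_and_card f).2
    ⟨hf, by rw [Sym2.card_subtype_not_diag, Fintype.card_fin, Fintype.card_fin]⟩
  exact hb.1 (Subtype.ext ((show s(_, _) = _ from hk).trans (show s(_, _) = _ from hl).symm))

variable {i j : Fin n} {k : Fin (n.choose 2)}

theorem Crosses.position_lt_of_le (hk : S.Crosses k i j) (hij : i < j) {t : ℕ} (ht : t ≤ k) :
    S.position t i < S.position t j := by
  refine position_lt_of_forall_not_crosses (Nat.zero_le _) (by omega) (fun s _ hs h => ?_)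
    (by simpa [position_zero] using hij)
  have := hk.unique h
  omega

theorem Crosses.eq_left_right (hk : S.Crosses k i j) (hij : i < j) :
    S.leftParticle k = i ∧ S.rightParticle k = j := by
  rcases crosses_iff.1 hk with h | ⟨rfl, rfl⟩
  · exact h
  have := hk.position_lt_of_le hij le_rfl
  rw [Fin.lt_def, position_leftParticle, position_rightParticle] at this
  omega

theorem Crosses.position_lt_of_lt (hk : S.Crosses k i j) (hij : i < j) {t : ℕ} (ht : (k : ℕ) < t)
    (htN : t ≤ n.choose 2) : S.position t j < S.position t i := by
  refine position_lt_of_forall_not_crosses (k := k + 1) ht htN (fun s hs _ h => ?_) ?_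
  · have := hk.unique h.symm
    omega
  · obtain ⟨rfl, rfl⟩ := hk.eq_left_right hij
    rw [Fin.lt_def, position_succ, position_succ, adjSwap_val, adjSwap_val,
      position_leftParticle, position_rightParticle]
    simp

theorem crosses_self (S : SortingNetwork n) (k : Fin (n.choose 2)) :
    S.Crosses k (S.leftParticle k) (S.rightParticle k) := rfl

theorem leftParticle_lt_rightParticle (S : SortingNetwork n) (k : Fin (n.choose 2)) :
    S.leftParticle k < S.rightParticle k := by
  rcases lt_or_gt_of_ne (S.leftParticle_ne_rightParticle k) with h | h
  · exact h
  · exact absurd ((S.crosses_self k).symm.eq_left_right h).1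
      (S.leftParticle_ne_rightParticle k)

/-- Of three strands, the crossing of the outer two is between the other two crossings. -/
theorem Crosses.lt_lt_or_lt_lt {i j m : Fin n} {r s t : Fin (n.choose 2)} (hij : i < j)
    (hjm : j < m) (hr : S.Crosses r i j) (hs : S.Crosses s i m) (ht : S.Crosses t j m) :
    r < s ∧ s < t ∨ t < s ∧ s < r := by
  have him := hij.trans hjm
  obtain ⟨hr₀, hr₁⟩ := hr.eq_left_right hij
  obtain ⟨hs₀, hs₁⟩ := hs.eq_left_right him
  obtain ⟨ht₀, ht₁⟩ := ht.eq_left_right hjm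
  have hrs : r ≠ s := by rintro rfl; exact hjm.ne (hr₁.symm.trans hs₁)
  have hst : s ≠ t := by rintro rfl; exact hij.ne (hs₀.symm.trans ht₀)
  -- Just before `s`, the strand `m` is the right neighbour of `i`. If `r` and `t` were both
  -- earlier, the order would be `m, j, i`; if both were later, `j` would lie strictly between `i`
  -- and `m`.
  have hpi : (S.position s i : ℕ) = S.word s := (S.eq_leftParticle_iff s i).1 hs₀.symm
  have hpm : (S.position s m : ℕ) = S.word s + 1 := (S.eq_rightParticle_iff s m).1 hs₁.symm
  rcases lt_or_gt_of_ne hrs with h | h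
  · refine Or.inl ⟨h, lt_of_le_of_ne (not_lt.1 fun h' => ?_) hst⟩
    have h₁ := hr.position_lt_of_lt hij h s.2.le
    have h₂ := ht.position_lt_of_lt hjm h' s.2.le
    rw [Fin.lt_def] at h₁ h₂
    omega
  · refine Or.inr ⟨lt_of_le_of_ne (not_lt.1 fun h' => ?_) hst.symm, h⟩
    have h₁ := hr.position_lt_of_le hij (le_of_lt h : (s : ℕ) ≤ r)
    have h₂ := ht.position_lt_of_le hjm (le_of_lt h' : (s : ℕ) ≤ t)
    rw [Fin.lt_def] at h₁ h₂
    omega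

end SortingNetwork

/-! ### Inversion sets and orders -/

variable {n : ℕ}

theorem inv_eq_one_iff {p : Equiv.Perm (Fin n)} {i j : Fin n} : inv p i j = 1 ↔ p j < p i := by
  rw [inv]
  split_ifs with h <;> simp [h]

theorem units_eq_of_eq_one_iff {a b : ℤˣ} (h : a = 1 ↔ b = 1) : a = b := by
  rcases Int.units_eq_one_or a with rfl | rfl <;> rcases Int.units_eq_one_or b with rfl | rfl <;>
    simp_all

/-- The signature of `S` read off from the inversions of `p`. -/
def inversionSignature (S : SortingNetwork n) (p : Equiv.Perm (Fin n)) : Signature n :=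
  fun k => inv p (S.leftParticle k) (S.rightParticle k)

theorem isInversionSet_iff {S : SortingNetwork n} {σ : Signature n} {p : Equiv.Perm (Fin n)} :
    IsInversionSet S σ p ↔ inversionSignature S p = σ := by
  constructor
  · intro h
    funext k
    exact (h _ _ (S.leftParticle_lt_rightParticle k) k rfl).symm
  · rintro rfl i j hij k hk
    obtain ⟨rfl, rfl⟩ := hk.eq_left_right hij
    rfl

/-- All pairs cross, so the signature determines how `p` orders any two strands. If `q` orders them
alike, `q ∘ p⁻¹` is an order automorphism of `Fin n`, hence the identity. -/
theorem inversionSignature_injective (S : SortingNetwork n) :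
    Function.Injective (inversionSignature S) := by
  intro p q h
  have key : ∀ i j : Fin n, i < j → (p j < p i ↔ q j < q i) := by
    intro i j hij
    obtain ⟨k, hk⟩ := S.exists_crosses hij.ne
    rw [← inv_eq_one_iff, ← inv_eq_one_iff, ← isInversionSet_iff.2 h i j hij k hk,
      ← isInversionSet_iff.2 rfl i j hij k hk]
  have key' : ∀ i j : Fin n, p i < p j ↔ q i < q j := by
    intro i j
    rcases lt_trichotomy i j with hij | rfl | hij
    · have := key i j hij
      have h₁ : p i ≠ p j := fun h => hij.ne (p.injective h)
      have h₂ : q i ≠ q j := fun h => hij.ne (q.injective h)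
      grind
    · simp
    · exact key j i hij
  have hm : StrictMono (p⁻¹.trans q) := by
    intro i j hij
    simpa [← key'] using hij
  have hs : (p⁻¹.trans q) = 1 := by
    have := Subsingleton.elim (hm.orderIsoOfSurjective _ (Equiv.surjective _))
      (OrderIso.refl (Fin n))
    exact Equiv.ext fun x => congrArg (fun e : Fin n ≃o Fin n => e x) this
  refine Equiv.ext fun x => ?_
  simpa using (congrArg (fun e : Equiv.Perm (Fin n) => e (p x)) hs).symm

theorem card_inversionSets (S : SortingNetwork n) :
    Nat.card {σ : Signature n // ∃ p : Equiv.Perm (Fin n), IsInversionSet S σ p} =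
      n.factorial := by
  have : Nat.card (Set.range (inversionSignature S)) = n.factorial := by
    rw [Nat.card_range_of_injective (inversionSignature_injective S), Nat.card_perm, Nat.card_fin]
  simp only [isInversionSet_iff]
  exact this

theorem exists_perm_of_isStrictTotalOrder (r : Fin n → Fin n → Prop)
    [hr : IsStrictTotalOrder (Fin n) r] :
    ∃ p : Equiv.Perm (Fin n), ∀ i j, p j < p i ↔ r i j := by
  classical
  -- The rank of `i`: the number of elements below it.
  let c : Fin n → ℕ := fun i => (Finset.univ.filter fun j => r i j).card
  have hc : ∀ i j, r i j → c j < c i := by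
    intro i j hij
    refine Finset.card_lt_card ?_
    rw [Finset.ssubset_iff_of_subset]
    · exact ⟨j, by simpa using hij, by simpa using irrefl_of r j⟩
    · intro x hx
      simp only [Finset.mem_filter, Finset.mem_univ, true_and] at hx ⊢
      exact trans_of r hij hx
  have hlt : ∀ i, c i < n := by
    intro i
    calc c i < (Finset.univ : Finset (Fin n)).card := by
          refine Finset.card_lt_card ((Finset.ssubset_iff_of_subset (Finset.subset_univ _)).2
            ⟨i, Finset.mem_univ i, by simpa using irrefl_of r i⟩)
      _ = n := by simp
  let f : Fin n → Fin n := fun i => ⟨c i, hlt i⟩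
  have hf : Function.Injective f := by
    intro i j h
    have h' : c i = c j := by simpa [f] using h
    rcases trichotomous_of r i j with h₁ | h₁ | h₁
    · have := hc _ _ h₁; omega
    · exact h₁
    · have := hc _ _ h₁; omega
  refine ⟨Equiv.ofBijective f (Finite.injective_iff_bijective.1 hf), fun i j => ?_⟩
  refine ⟨fun h => ?_, fun h => hc i j h⟩
  rcases trichotomous_of r i j with h₁ | rfl | h₁
  · exact h₁
  · exact absurd h (lt_irrefl _)
  · exact absurd h (lt_asymm (show f i < f j from hc j i h₁))

theorem exists_isInversionSet_iff_exists_order (S : SortingNetwork n) (σ : Signature n) :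
    (∃ p : Equiv.Perm (Fin n), IsInversionSet S σ p) ↔
      ∃ r : Fin n → Fin n → Prop, IsStrictTotalOrder (Fin n) r ∧ ComesFromOrder S σ r := by
  constructor
  · rintro ⟨p, hp⟩
    refine ⟨fun i j => p j < p i, ?_, ?_⟩
    · exact
        { irrefl := fun i => lt_irrefl (p i)
          trans := fun i j k hij hjk => lt_trans hjk hij
          trichotomous := fun i j h₁ h₂ => p.injective (le_antisymm (not_lt.1 h₁) (not_lt.1 h₂)) }
    · intro i j hij k hk
      rw [hp i j hij k hk, inv_eq_one_iff]
  · rintro ⟨r, hr, h⟩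
    obtain ⟨p, hp⟩ := exists_perm_of_isStrictTotalOrder r
    refine ⟨p, fun i j hij k hk => units_eq_of_eq_one_iff ?_⟩
    rw [h i j hij k hk, inv_eq_one_iff, hp]

/-- A signature without cyclic triples comes from a total order. -/
theorem exists_order_of_triples (S : SortingNetwork n) (σ : Signature n)
    (h : ∀ (i j m : Fin n) (r s t : Fin (n.choose 2)), i < j → j < m → S.Crosses r i j →
      S.Crosses s i m → S.Crosses t j m → σ r = σ t → σ s = σ r) :
    ∃ r : Fin n → Fin n → Prop, IsStrictTotalOrder (Fin n) r ∧ ComesFromOrder S σ r := by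
  have hex : ∀ i j : Fin n, i < j → ∃ k, S.Crosses k i j := fun i j hij => S.exists_crosses hij.ne
  choose T hT using hex
  let r : Fin n → Fin n → Prop := fun i j =>
    (∃ hij : i < j, σ (T i j hij) = 1) ∨ (∃ hij : j < i, σ (T j i hij) ≠ 1)
  have hlt : ∀ {i j} (hij : i < j), r i j ↔ σ (T i j hij) = 1 := fun hij => by
    simp [r, hij, hij.not_gt]
  have hgt : ∀ {i j} (hij : j < i), r i j ↔ ¬σ (T j i hij) = 1 := fun hij => by
    simp [r, hij, hij.not_gt]
  have htri : ∀ i j m (hij : i < j) (hjm : j < m),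
      (σ (T i j hij) = 1 → σ (T j m hjm) = 1 → σ (T i m (hij.trans hjm)) = 1) ∧
      (σ (T i j hij) ≠ 1 → σ (T j m hjm) ≠ 1 → σ (T i m (hij.trans hjm)) ≠ 1) := by
    intro i j m hij hjm
    have := h i j m _ _ _ hij hjm (hT i j hij) (hT i m (hij.trans hjm)) (hT j m hjm)
    refine ⟨fun h₁ h₂ => (this (h₁.trans h₂.symm)).trans h₁, fun h₁ h₂ => ?_⟩
    rw [this]
    · exact h₁
    · exact units_eq_of_eq_one_iff (by simp [h₁, h₂])
  have hirr : ∀ i, ¬r i i := fun i => by simp [r]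
  have htot : ∀ i j, ¬r i j → ¬r j i → i = j := by
    intro i j h₁ h₂
    rcases lt_trichotomy i j with hij | hij | hij
    · rw [hlt hij] at h₁
      rw [hgt hij] at h₂
      exact absurd h₁ h₂
    · exact hij
    · rw [hgt hij] at h₁
      rw [hlt hij] at h₂
      exact absurd h₂ h₁
  -- Each of the six orders of distinct `i`, `j`, `m` is one half of `htri`, taken directly or by
  -- contraposition.
  have htrans : ∀ i j m, r i j → r j m → r i m := by
    intro i j m h₁ h₂
    rcases lt_trichotomy i j with hij | rfl | hij
    · rcases lt_trichotomy j m with hjm | rfl | hjm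
      · rw [hlt hij] at h₁; rw [hlt hjm] at h₂; rw [hlt (hij.trans hjm)]
        exact (htri i j m hij hjm).1 h₁ h₂
      · exact h₁
      · rw [hlt hij] at h₁; rw [hgt hjm] at h₂
        rcases lt_trichotomy i m with him | rfl | him
        · rw [hlt him]; by_contra h₃
          exact (htri i m j him hjm).2 h₃ h₂ h₁
        · exact absurd h₁ h₂
        · rw [hgt him]; intro h₃
          exact h₂ ((htri m i j him hij).1 h₃ h₁)
    · exact h₂
    · rcases lt_trichotomy j m with hjm | rfl | hjm
      · rw [hgt hij] at h₁; rw [hlt hjm] at h₂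
        rcases lt_trichotomy i m with him | rfl | him
        · rw [hlt him]; by_contra h₃
          exact (htri j i m hij him).2 h₁ h₃ h₂
        · exact absurd h₂ h₁
        · rw [hgt him]; intro h₃
          exact h₁ ((htri j m i hjm him).1 h₂ h₃)
      · exact h₁
      · rw [hgt hij] at h₁; rw [hgt hjm] at h₂; rw [hgt (hjm.trans hij)]
        exact (htri m j i hjm hij).2 h₂ h₁
  refine ⟨r, { irrefl := hirr, trans := htrans, trichotomous := htot }, ?_⟩
  intro i j hij k hk
  rw [hlt hij, hk.unique (hT i j hij)]


/-! ### The positive lift of a permutation to the braid group -/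

section Lift

variable {n : ℕ}

theorem gen_mul_gen_of_add_two_le {i j : Fin (n - 1)} (h : (i : ℕ) + 2 ≤ j) :
    (gen i * gen j : BraidGroup n) = gen j * gen i :=
  mul_inv_eq_one.1 (PresentedGroup.one_of_mem (rels := braidRels n) (Or.inl ⟨i, j, h, rfl⟩))

theorem gen_mul_gen_mul_gen {i j : Fin (n - 1)} (h : (i : ℕ) + 1 = j) :
    (gen i * gen j * gen i : BraidGroup n) = gen j * gen i * gen j :=
  mul_inv_eq_one.1 (PresentedGroup.one_of_mem (rels := braidRels n) (Or.inr ⟨i, j, h, rfl⟩))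

theorem adjSwap_mul_adjSwap_of_add_two_le {i j : Fin (n - 1)} (h : (i : ℕ) + 2 ≤ j) :
    adjSwap i * adjSwap j = adjSwap j * adjSwap i := by
  ext x
  simp only [Equiv.Perm.mul_apply, adjSwap_val]
  split_ifs <;> omega

theorem adjSwap_mul_adjSwap_mul_adjSwap {i j : Fin (n - 1)} (h : (i : ℕ) + 1 = j) :
    adjSwap i * adjSwap j * adjSwap i = adjSwap j * adjSwap i * adjSwap j := by
  have hj := j.2
  have e : (⟨j, by omega⟩ : Fin n) = ⟨i + 1, by omega⟩ := Fin.ext h.symm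
  rw [adjSwap, adjSwap, e, Equiv.swap_mul_swap_mul_swap (by simp) (by simp; omega),
    Equiv.swap_comm (⟨i, _⟩ : Fin n), Equiv.swap_comm _ (⟨j + 1, _⟩ : Fin n),
    Equiv.swap_mul_swap_mul_swap (by simp; omega) (by simp; omega), Equiv.swap_comm]

/-- The permutation `u` decreases from the position `i` to the position `i + 1`. -/
def IsDescent (u : Equiv.Perm (Fin n)) (i : Fin (n - 1)) : Prop :=
  u ⟨i + 1, by omega⟩ < u ⟨i, by omega⟩

/-- A measure of disorder which drops when a descent is removed. -/
def disorder (u : Equiv.Perm (Fin n)) : ℕ := ∑ x : Fin n, (x : ℕ) * ((u x).rev : ℕ)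

theorem disorder_mul_adjSwap_lt {u : Equiv.Perm (Fin n)} {i : Fin (n - 1)} (h : IsDescent u i) :
    disorder (u * adjSwap i) < disorder u := by
  have hne : (⟨i, by omega⟩ : Fin n) ≠ ⟨i + 1, by omega⟩ := by simp
  have hd : ∀ v : Equiv.Perm (Fin n), disorder v =
      (i : ℕ) * ((v ⟨i, by omega⟩).rev : ℕ) + ((i + 1 : ℕ) * ((v ⟨i + 1, by omega⟩).rev : ℕ) +
        ∑ x ∈ (Finset.univ.erase (⟨i, by omega⟩ : Fin n)).erase ⟨i + 1, by omega⟩,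
          (x : ℕ) * ((v x).rev : ℕ)) := by
    intro v
    rw [disorder, ← Finset.add_sum_erase _ _ (Finset.mem_univ (⟨i, by omega⟩ : Fin n)),
      ← Finset.add_sum_erase _ _ (Finset.mem_erase.2 ⟨hne.symm, Finset.mem_univ _⟩)]
  rw [hd, hd u]
  have hsum : ∑ x ∈ (Finset.univ.erase (⟨i, by omega⟩ : Fin n)).erase ⟨i + 1, by omega⟩,
      (x : ℕ) * (((u * adjSwap i) x).rev : ℕ) =
      ∑ x ∈ (Finset.univ.erase (⟨i, by omega⟩ : Fin n)).erase ⟨i + 1, by omega⟩,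
      (x : ℕ) * ((u x).rev : ℕ) := by
    refine Finset.sum_congr rfl fun x hx => ?_
    simp only [Finset.mem_erase, Finset.mem_univ, and_true, ne_eq, Fin.ext_iff] at hx
    rw [Equiv.Perm.mul_apply, adjSwap_of_ne i hx.2 hx.1]
  rw [hsum, Equiv.Perm.mul_apply, Equiv.Perm.mul_apply, adjSwap_left, adjSwap_right]
  have h' := Fin.rev_lt_rev.2 h
  rw [Fin.lt_def] at h'
  nlinarith

open Classical in
/-- The positive braid lifting the permutation `u`, with as few crossings as possible. -/
noncomputable def positiveLift (u : Equiv.Perm (Fin n)) : BraidGroup n :=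
  if h : ∃ i, IsDescent u i then positiveLift (u * adjSwap h.choose) * gen h.choose else 1
termination_by disorder u
decreasing_by exact disorder_mul_adjSwap_lt h.choose_spec

theorem isDescent_mul_adjSwap_of_far {u : Equiv.Perm (Fin n)} {i j : Fin (n - 1)}
    (h : (i : ℕ) + 2 ≤ j ∨ (j : ℕ) + 2 ≤ i) (hi : IsDescent u i) :
    IsDescent (u * adjSwap j) i := by
  rw [IsDescent, Equiv.Perm.mul_apply, Equiv.Perm.mul_apply, adjSwap_of_ne, adjSwap_of_ne]
  · exact hi
  all_goals simp only [ne_eq]; omega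

/-- The values at three consecutive positions decrease, so both ways of sorting them, `i j i` and `j
i j`, remove a descent at every step. -/
theorem isDescent_of_adjacent {u : Equiv.Perm (Fin n)} {i j : Fin (n - 1)}
    (h : (i : ℕ) + 1 = j) (hi : IsDescent u i) (hj : IsDescent u j) :
    IsDescent (u * adjSwap i) j ∧ IsDescent (u * adjSwap i * adjSwap j) i ∧
      IsDescent (u * adjSwap j) i ∧ IsDescent (u * adjSwap j * adjSwap i) j := by
  have hjn := j.2
  have e : (⟨j, by omega⟩ : Fin n) = ⟨i + 1, by omega⟩ := Fin.ext h.symm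
  have hi' : u ⟨i + 1, by omega⟩ < u ⟨i, by omega⟩ := hi
  have hj' : u ⟨j + 1, by omega⟩ < u ⟨j, by omega⟩ := hj
  have h₀ : adjSwap i ⟨j + 1, by omega⟩ = (⟨j + 1, by omega⟩ : Fin n) :=
    adjSwap_of_ne _ (by simp; omega) (by simp; omega)
  have h₁ : adjSwap i ⟨j, by omega⟩ = (⟨i, by omega⟩ : Fin n) := by rw [e, adjSwap_right]
  have h₂ : adjSwap j ⟨i, by omega⟩ = (⟨i, by omega⟩ : Fin n) :=
    adjSwap_of_ne _ (by simp; omega) (by simp; omega)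
  have h₃ : adjSwap j ⟨i + 1, by omega⟩ = (⟨j + 1, by omega⟩ : Fin n) := by
    rw [← e, adjSwap_left]
  have h₄ := adjSwap_left i
  have h₅ := adjSwap_right j
  simp only [IsDescent, Equiv.Perm.mul_apply, h₀, h₁, h₂, h₃, h₄, h₅]
  rw [e] at hj' ⊢
  exact ⟨hj'.trans hi', hj', hj'.trans hi', hi'⟩

/-- The lift does not depend on the descent chosen in its definition. By induction on `disorder`,
two competing descents can be continued to a common permutation, and the two words obtained differ
by a single braid relation. -/
theorem positiveLift_of_isDescent {u : Equiv.Perm (Fin n)} {i : Fin (n - 1)}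
    (hi : IsDescent u i) : positiveLift u = positiveLift (u * adjSwap i) * gen i := by
  have hex : ∃ i, IsDescent u i := ⟨i, hi⟩
  obtain ⟨j, hj, hu⟩ : ∃ j, IsDescent u j ∧
      positiveLift u = positiveLift (u * adjSwap j) * gen j := by
    refine ⟨hex.choose, hex.choose_spec, ?_⟩
    conv_lhs => rw [positiveLift, dif_pos hex]
  have adjacent : ∀ a b : Fin (n - 1), (a : ℕ) + 1 = b → IsDescent u a → IsDescent u b →
      positiveLift (u * adjSwap a) * gen a = positiveLift (u * adjSwap b) * gen b := by
    intro a b hab ha hb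
    obtain ⟨h₁, h₂, h₃, h₄⟩ := isDescent_of_adjacent hab ha hb
    have ma := disorder_mul_adjSwap_lt ha
    have mb := disorder_mul_adjSwap_lt hb
    have m₁ := disorder_mul_adjSwap_lt h₁
    have m₃ := disorder_mul_adjSwap_lt h₃
    rw [positiveLift_of_isDescent h₁, positiveLift_of_isDescent h₂,
      positiveLift_of_isDescent h₃, positiveLift_of_isDescent h₄]
    have hu : u * adjSwap a * adjSwap b * adjSwap a = u * adjSwap b * adjSwap a * adjSwap b := by
      simpa only [mul_assoc] using congrArg (u * ·) (adjSwap_mul_adjSwap_mul_adjSwap hab)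
    have hg := gen_mul_gen_mul_gen hab
    simp only [mul_assoc] at hu hg ⊢
    rw [hu, hg]
  have far : ∀ a b : Fin (n - 1), (a : ℕ) + 2 ≤ b → IsDescent u a → IsDescent u b →
      positiveLift (u * adjSwap a) * gen a = positiveLift (u * adjSwap b) * gen b := by
    intro a b hab ha hb
    have ma := disorder_mul_adjSwap_lt ha
    have mb := disorder_mul_adjSwap_lt hb
    rw [positiveLift_of_isDescent (isDescent_mul_adjSwap_of_far (Or.inr hab) hb),
      positiveLift_of_isDescent (isDescent_mul_adjSwap_of_far (Or.inl hab) ha)]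
    have hu : u * adjSwap a * adjSwap b = u * adjSwap b * adjSwap a := by
      rw [mul_assoc, adjSwap_mul_adjSwap_of_add_two_le hab, mul_assoc]
    rw [hu, mul_assoc _ (gen b), mul_assoc _ (gen a), gen_mul_gen_of_add_two_le hab]
  rw [hu]
  rcases lt_trichotomy (i : ℕ) j with h | h | h
  · rcases Nat.lt_or_ge ((i : ℕ) + 1) j with h' | h'
    · exact (far i j h' hi hj).symm
    · exact (adjacent i j (by omega) hi hj).symm
  · rw [Fin.ext h]
  · rcases Nat.lt_or_ge ((j : ℕ) + 1) i with h' | h'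
    · exact far j i h' hj hi
    · exact adjacent j i (by omega) hj hi
termination_by disorder u

/-- At an ascent of `u`, the descent of `u * adjSwap i` is removed; at a descent, that of `u`
itself. Words need not be reduced. -/
theorem positiveLift_mul_adjSwap (u : Equiv.Perm (Fin n)) (i : Fin (n - 1)) (ε : ℤˣ)
    (hε : ε = 1 ↔ u ⟨i, by omega⟩ < u ⟨i + 1, by omega⟩) :
    positiveLift (u * adjSwap i) = positiveLift u * gen i ^ (ε : ℤ) := by
  rcases Int.units_eq_one_or ε with rfl | rfl
  · have h : IsDescent (u * adjSwap i) i := by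
      rw [IsDescent, Equiv.Perm.mul_apply, Equiv.Perm.mul_apply, adjSwap_left, adjSwap_right]
      exact hε.1 rfl
    rw [positiveLift_of_isDescent h, mul_assoc, adjSwap_mul_self]
    simp
  · have h : IsDescent u i := by
      refine lt_of_le_of_ne (not_lt.1 fun h => by simpa using hε.2 h) fun h => ?_
      simpa using u.injective h
    rw [positiveLift_of_isDescent h]
    simp

/-- Each factor is the quotient of the lifts of two successive permutations, so the product
telescopes. -/
theorem prod_gen_zpow_eq_positiveLift {N : ℕ} (f : Fin N → Fin (n - 1)) (ε : Fin N → ℤˣ)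
    (u : Equiv.Perm (Fin n))
    (h : ∀ k : Fin N, ε k = 1 ↔
      (u * ((List.ofFn fun l => adjSwap (f l)).take k).prod) ⟨f k, by omega⟩ <
        (u * ((List.ofFn fun l => adjSwap (f l)).take k).prod) ⟨f k + 1, by omega⟩) :
    (List.ofFn fun k => gen (f k) ^ (ε k : ℤ)).prod =
      (positiveLift u)⁻¹ * positiveLift (u * (List.ofFn fun l => adjSwap (f l)).prod) := by
  have key : ∀ k ≤ N, ((List.ofFn fun k => gen (f k) ^ (ε k : ℤ)).take k).prod =
      (positiveLift u)⁻¹ *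
        positiveLift (u * ((List.ofFn fun l => adjSwap (f l)).take k).prod) := by
    intro k hk
    induction k with
    | zero => simp
    | succ k ih =>
      have e₁ := ofFn_take_succ_prod (fun k => gen (f k) ^ (ε k : ℤ)) ⟨k, hk⟩
      have e₂ := ofFn_take_succ_prod (fun l => adjSwap (f l)) ⟨k, hk⟩
      simp only at e₁ e₂
      rw [e₁, e₂, ih (by omega), ← mul_assoc u, positiveLift_mul_adjSwap _ _ _ (h ⟨k, hk⟩),
        mul_assoc]
  have := key N le_rfl
  rwa [ofFn_take_prod, ofFn_take_prod] at this

/-! ### The mirrored word -/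

theorem adjSwap_rev (i : Fin (n - 1)) :
    adjSwap i.rev = Fin.revPerm * adjSwap i * Fin.revPerm := by
  ext x
  simp only [Equiv.Perm.mul_apply, Fin.revPerm_apply, adjSwap_val, Fin.val_rev]
  split_ifs <;> omega

theorem revPerm_mul_revPerm : (Fin.revPerm * Fin.revPerm : Equiv.Perm (Fin n)) = 1 := by
  ext x
  simp

theorem SortingNetwork.take_prod_adjSwap_rev (S : SortingNetwork n) {k : ℕ}
    (hk : k ≤ n.choose 2) :
    ((List.ofFn fun l => adjSwap (S.word l).rev).take k).prod =
      Fin.revPerm * S.configuration k * Fin.revPerm := by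
  induction k with
  | zero => simp [S.configuration_zero, revPerm_mul_revPerm]
  | succ k ih =>
    have e₁ := ofFn_take_succ_prod (fun l => adjSwap (S.word l).rev) ⟨k, hk⟩
    have e₂ := S.configuration_succ ⟨k, hk⟩
    simp only at e₁ e₂
    rw [e₁, e₂, ih (by omega), adjSwap_rev]
    simp only [mul_assoc]
    rw [← mul_assoc Fin.revPerm Fin.revPerm, revPerm_mul_revPerm, one_mul]

theorem SortingNetwork.prod_adjSwap_rev (S : SortingNetwork n) :
    (List.ofFn fun l => adjSwap (S.word l).rev).prod = Fin.revPerm := by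
  rw [← ofFn_take_prod, S.take_prod_adjSwap_rev le_rfl, S.configuration_end,
    revPerm_mul_revPerm, one_mul]

theorem algebraicSortingBraid_eq_one {S : SortingNetwork n} {σ : Signature n}
    {p : Equiv.Perm (Fin n)} (h : IsInversionSet S σ p) : algebraicSortingBraid S σ = 1 := by
  have hσ : ∀ k, σ k = 1 ↔ p (S.rightParticle k) < p (S.leftParticle k) := fun k => by
    rw [h _ _ (S.leftParticle_lt_rightParticle k) k rfl, inv_eq_one_iff]
  -- `σ` is `+` where `p` descends, whereas the lift gains a positive generator at ascents; hence
  -- `revPerm * p` instead of `p`.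
  have h₁ := prod_gen_zpow_eq_positiveLift S.word σ (Fin.revPerm * p) fun k => by
    rw [hσ]
    exact Fin.rev_lt_rev.symm
  -- The second half starts where the first one ends, and its own end is `revPerm * p` again.
  have h₂ := prod_gen_zpow_eq_positiveLift (fun k => (S.word k).rev) (fun k => -σ k)
    (Fin.revPerm * p * Fin.revPerm) fun k => by
      have e : Fin.revPerm * p * Fin.revPerm *
          ((List.ofFn fun l => adjSwap (S.word l).rev).take k).prod =
          Fin.revPerm * p * S.configuration k * Fin.revPerm := by
        rw [S.take_prod_adjSwap_rev k.2.le]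
        simp only [mul_assoc]
        rw [← mul_assoc Fin.revPerm Fin.revPerm, revPerm_mul_revPerm, one_mul]
      have hk := (S.word k).2
      have el : (⟨(S.word k).rev, by omega⟩ : Fin n).rev = ⟨S.word k + 1, by omega⟩ := by
        ext; simp only [Fin.val_rev]; omega
      have er : (⟨(S.word k).rev + 1, by omega⟩ : Fin n).rev = ⟨S.word k, by omega⟩ := by
        ext; simp only [Fin.val_rev]; omega
      rw [e]
      simp only [Equiv.Perm.mul_apply, Fin.revPerm_apply, el, er, Fin.rev_lt_rev]
      change _ ↔ p (S.leftParticle k) < p (S.rightParticle k)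
      have hne : p (S.leftParticle k) ≠ p (S.rightParticle k) := fun h =>
        S.leftParticle_ne_rightParticle k (p.injective h)
      have := hσ k
      rcases Int.units_eq_one_or (σ k) with h | h <;> simp only [h] at this ⊢ <;> simp at this ⊢
      · exact this.le
      · exact lt_of_le_of_ne this hne
  simp only [Units.val_neg] at h₂
  rw [algebraicSortingBraid, h₁, h₂, S.prod_word, S.prod_adjSwap_rev,
    mul_assoc _ Fin.revPerm Fin.revPerm, revPerm_mul_revPerm, mul_one]
  group

end Lift


/-! ### The Hurwitz action of braids on tuples of group elements -/

section Hurwitz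

variable {G : Type*} [Group G]

/-- The action of a generator of the braid group on tuples: `(a, b) ↦ (a b a⁻¹, a)` at the
positions `i`, `i + 1`. -/
def hurwitzStep {n : ℕ} (i : Fin (n - 1)) : Equiv.Perm (Fin n → G) where
  toFun v x := if (x : ℕ) = i then v ⟨i, by omega⟩ * v ⟨i + 1, by omega⟩ * (v ⟨i, by omega⟩)⁻¹
    else if (x : ℕ) = i + 1 then v ⟨i, by omega⟩ else v x
  invFun v x := if (x : ℕ) = i then v ⟨i + 1, by omega⟩
    else if (x : ℕ) = i + 1 then (v ⟨i + 1, by omega⟩)⁻¹ * v ⟨i, by omega⟩ * v ⟨i + 1, by omega⟩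
    else v x
  left_inv v := by
    funext x
    by_cases h : (x : ℕ) = i
    · rw [show x = ⟨i, by omega⟩ from Fin.ext h]
      simp
    by_cases h' : (x : ℕ) = i + 1
    · rw [show x = ⟨i + 1, by omega⟩ from Fin.ext h']
      simp [mul_assoc]
    simp [h, h']
  right_inv v := by
    funext x
    by_cases h : (x : ℕ) = i
    · rw [show x = ⟨i, by omega⟩ from Fin.ext h]
      simp [mul_assoc]
    by_cases h' : (x : ℕ) = i + 1
    · rw [show x = ⟨i + 1, by omega⟩ from Fin.ext h']
      simp
    simp [h, h']

theorem hurwitzStep_apply {n : ℕ} (i : Fin (n - 1)) (v : Fin n → G) (x : Fin n) :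
    hurwitzStep i v x =
      if (x : ℕ) = i then v ⟨i, by omega⟩ * v ⟨i + 1, by omega⟩ * (v ⟨i, by omega⟩)⁻¹
      else if (x : ℕ) = i + 1 then v ⟨i, by omega⟩ else v x := rfl

theorem hurwitzStep_inv_apply {n : ℕ} (i : Fin (n - 1)) (v : Fin n → G) (x : Fin n) :
    (hurwitzStep i)⁻¹ v x =
      if (x : ℕ) = i then v ⟨i + 1, by omega⟩
      else if (x : ℕ) = i + 1 then
        (v ⟨i + 1, by omega⟩)⁻¹ * v ⟨i, by omega⟩ * v ⟨i + 1, by omega⟩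
      else v x := rfl

theorem hurwitzStep_eq_self {n : ℕ} {i : Fin (n - 1)} {v : Fin n → G}
    (h : v ⟨i + 1, by omega⟩ = v ⟨i, by omega⟩) : hurwitzStep i v = v := by
  funext x
  rw [hurwitzStep_apply]
  split_ifs with h₁ h₂
  · rw [show x = ⟨i, by omega⟩ from Fin.ext h₁, h, mul_inv_cancel_right]
  · rw [show x = ⟨i + 1, by omega⟩ from Fin.ext h₂, h]
  · rfl

theorem hurwitz_aux (G : Type*) [Group G] (n : ℕ) : ∀ w ∈ braidRels n,
    FreeGroup.lift (fun i : Fin (n - 1) => (hurwitzStep i : Equiv.Perm (Fin n → G))) w = 1 := by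
  rintro w (⟨i, j, hij, rfl⟩ | ⟨i, j, hij, rfl⟩)
  · simp only [map_mul, map_inv, FreeGroup.lift_apply_of, mul_inv_eq_one]
    ext v x
    simp only [Equiv.Perm.mul_apply, hurwitzStep_apply]
    split_ifs <;> first | rfl | omega
  · simp only [map_mul, map_inv, FreeGroup.lift_apply_of, mul_inv_eq_one]
    ext v x
    simp only [Equiv.Perm.mul_apply, hurwitzStep_apply, ← hij]
    split_ifs <;> first | rfl | omega | simp [mul_assoc]

/-- The Hurwitz action of the braid group on tuples of elements of `G`. -/
def hurwitz (G : Type*) [Group G] (n : ℕ) : BraidGroup n →* Equiv.Perm (Fin n → G) :=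
  PresentedGroup.toGroup (hurwitz_aux G n)

@[simp]
theorem hurwitz_gen {n : ℕ} (i : Fin (n - 1)) : hurwitz G n (gen i) = hurwitzStep i :=
  PresentedGroup.toGroup.of _

theorem braidGroup_induction {n : ℕ} {P : BraidGroup n → Prop} (one : P 1)
    (gen : ∀ i, P (gen i)) (inv : ∀ a, P a → P a⁻¹) (mul : ∀ a b, P a → P b → P (a * b))
    (b : BraidGroup n) : P b := by
  induction b using PresentedGroup.induction_on with
  | _ z =>
    induction z using FreeGroup.induction_on with
    | C1 => simpa using one
    | of i => exact gen i
    | inv_of i h => exact inv _ (gen i)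
    | mul x y hx hy => simpa using mul _ _ hx hy

@[simp]
theorem addStrand_gen {n : ℕ} (i : Fin (n - 1)) :
    addStrand n (gen i) = gen (i.castLE (by omega)) :=
  PresentedGroup.toGroup.of _

theorem hurwitz_addStrand {n : ℕ} (b : BraidGroup n) (v : Fin (n + 1) → G) :
    hurwitz G (n + 1) (addStrand n b) v =
      Fin.snoc (α := fun _ => G) (hurwitz G n b (Fin.init v)) (v (Fin.last n)) := by
  induction b using braidGroup_induction generalizing v with
  | one => simp
  | gen i =>
    funext x
    refine Fin.lastCases ?_ (fun x => ?_) x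
    · rw [Fin.snoc_last, addStrand_gen, hurwitz_gen, hurwitzStep_apply]
      simp only [Fin.val_last, Fin.val_castLE]
      rw [if_neg (by omega), if_neg (by omega)]
    · rw [Fin.snoc_castSucc, addStrand_gen, hurwitz_gen, hurwitz_gen, hurwitzStep_apply,
        hurwitzStep_apply]
      rfl
  | inv a ih =>
    rw [map_inv, map_inv, map_inv, Equiv.Perm.inv_eq_iff_eq, ih]
    simp
  | mul a b iha ihb => simp [iha, ihb]

/-- The number of tuples fixed by a braid, that is, of homomorphisms to `G` from the group of
the closure of the braid. -/
noncomputable def fixedTuples (G : Type*) [Group G] (b : Σ n, BraidGroup n) : ℕ :=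
  Nat.card {v : Fin b.1 → G // hurwitz G b.1 b.2 v = v}

/-- `addStrand` leaves the last entry alone, so in a fixed tuple `g` must already preserve it. This
forces the last two entries to agree; `g` then acts trivially, and forgetting the last entry is a
bijection. -/
theorem card_fixedTuples_stabilization {n : ℕ} (b : BraidGroup (n + 1))
    (g : BraidGroup (n + 2))
    (hg : ∀ v : Fin (n + 2) → G, hurwitz G (n + 2) g v (Fin.last (n + 1)) = v (Fin.last (n + 1)) →
      v (Fin.last (n + 1)) = v (Fin.last n).castSucc)
    (hg' : ∀ v : Fin (n + 2) → G, v (Fin.last (n + 1)) = v (Fin.last n).castSucc →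
      hurwitz G (n + 2) g v = v) :
    fixedTuples G ⟨n + 2, addStrand (n + 1) b * g⟩ = fixedTuples G ⟨n + 1, b⟩ := by
  have key : ∀ v : Fin (n + 2) → G, hurwitz G (n + 2) (addStrand (n + 1) b * g) v = v ↔
      v (Fin.last (n + 1)) = v (Fin.last n).castSucc ∧
        hurwitz G (n + 1) b (Fin.init v) = Fin.init v := by
    intro v
    rw [map_mul, Equiv.Perm.mul_apply, hurwitz_addStrand]
    constructor
    · intro h
      have h₁ := hg v (by simpa using congrFun h (Fin.last (n + 1)))
      refine ⟨h₁, ?_⟩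
      rw [hg' v h₁] at h
      simpa using congrArg Fin.init h
    · rintro ⟨h₁, h₂⟩
      rw [hg' v h₁, h₂, Fin.snoc_init_self]
  refine Nat.card_congr
    { toFun := fun v => ⟨Fin.init v.1, ((key v.1).1 v.2).2⟩
      invFun := fun w => ⟨Fin.snoc (α := fun _ => G) w.1 (w.1 (Fin.last n)), (key _).2
        ⟨by rw [Fin.snoc_last, Fin.snoc_castSucc], by rw [Fin.init_snoc]; exact w.2⟩⟩
      left_inv := fun v => Subtype.ext ?_
      right_inv := fun w => Subtype.ext (Fin.init_snoc (α := fun _ => G) _ _) }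
  have h := ((key v.1).1 v.2).1
  simp only [Fin.init]
  rw [← h]
  exact Fin.snoc_init_self v.1

theorem fixedTuples_eq_of_markovMove {a b : Σ n, BraidGroup n} (h : MarkovMove a b) :
    fixedTuples G a = fixedTuples G b := by
  cases h with
  | conj a b =>
    refine Nat.card_congr ((hurwitz G _ a).subtypeEquiv fun v => ?_)
    simp
  | stab_pos b =>
    refine (card_fixedTuples_stabilization b _ (fun v h => ?_) fun v h => ?_).symm
    · rw [hurwitz_gen, hurwitzStep_apply, if_neg (by simp), if_pos (by simp)] at h
      exact h.symm
    · rw [hurwitz_gen]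
      exact hurwitzStep_eq_self h
  | stab_neg b =>
    refine (card_fixedTuples_stabilization b _ (fun v h => ?_) fun v h => ?_).symm
    · rw [map_inv, hurwitz_gen, hurwitzStep_inv_apply, if_neg (by simp), if_pos (by simp)] at h
      change (v (Fin.last _))⁻¹ * v (Fin.last _).castSucc * v (Fin.last _) = v (Fin.last _) at h
      rw [mul_eq_right, inv_mul_eq_one] at h
      exact h
    · rw [map_inv, Equiv.Perm.inv_eq_iff_eq, hurwitz_gen]
      exact (hurwitzStep_eq_self h).symm

/-- The identity fixes all tuples. As `G` is finite, a braid with equally many fixed tuples fixes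
them all too. -/
theorem hurwitz_eq_one_of_hasTrivialClosure [Finite G] {n : ℕ} {b : BraidGroup n}
    (h : HasTrivialClosure b) : hurwitz G n b = 1 := by
  have hcard : fixedTuples G ⟨n, b⟩ = fixedTuples G ⟨n, 1⟩ := by
    have h : Relation.EqvGen MarkovMove ⟨n, b⟩ ⟨n, 1⟩ := h
    generalize (⟨n, b⟩ : Σ n, BraidGroup n) = x, (⟨n, 1⟩ : Σ n, BraidGroup n) = y at h ⊢
    induction h with
    | rel _ _ h => exact fixedTuples_eq_of_markovMove h
    | refl => rfl
    | symm _ _ _ ih => exact ih.symm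
    | trans _ _ _ _ _ ih₁ ih₂ => exact ih₁.trans ih₂
  by_contra hne
  obtain ⟨v, hv⟩ : ∃ v, ¬hurwitz G n b v = v := by
    by_contra! h'
    exact hne (Equiv.ext h')
  have hlt := Finite.card_subtype_lt (p := fun v => hurwitz G n b v = v) hv
  simp only [fixedTuples] at hcard
  rw [hcard] at hlt
  simp at hlt

end Hurwitz

/-! ### Labels of strands -/

section Labels

variable {G : Type*} [Group G]

/-- The change of the labels of the strands at a crossing, of sign `ε`, of the left strand `l`
and the right strand `r`. -/
def crossLabels {X : Type*} [DecidableEq X] (ε : ℤˣ) (l r : X) (v : X → G) : X → G :=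
  if ε = 1 then Function.update v r (v l * v r * (v l)⁻¹)
  else Function.update v l ((v r)⁻¹ * v l * v r)

/-- In `v ∘ c`, labels belong to particles and `c` tells which particle is where. The exchange of
positions goes into `c`, and what is left is the conjugation of one label. -/
theorem hurwitz_gen_zpow_comp {n : ℕ} (i : Fin (n - 1)) (ε : ℤˣ) (v : Fin n → G)
    (c : Equiv.Perm (Fin n)) :
    hurwitz G n (gen i ^ (ε : ℤ)) (v ∘ c) =
      crossLabels ε (c ⟨i, by omega⟩) (c ⟨i + 1, by omega⟩) v ∘ (c * adjSwap i) := by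
  funext x
  have hx : (x : ℕ) = i ∧ x = ⟨i, by omega⟩ ∨ (x : ℕ) = i + 1 ∧ x = ⟨i + 1, by omega⟩ ∨
      (x : ℕ) ≠ i ∧ (x : ℕ) ≠ i + 1 ∧ x ≠ ⟨i, by omega⟩ ∧ x ≠ ⟨i + 1, by omega⟩ := by
    simp only [Fin.ext_iff, ne_eq]
    omega
  have hs := adjSwap_of_ne i (x := x)
  have hl := adjSwap_left i
  have hr := adjSwap_right i
  rcases Int.units_eq_one_or ε with rfl | rfl
  · rw [Units.val_one, zpow_one, hurwitz_gen, hurwitzStep_apply, crossLabels, if_pos rfl]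
    rcases hx with ⟨h, h'⟩ | ⟨h, h'⟩ | ⟨h, h', h₀, h₁⟩
    · rw [if_pos h, h']
      simp [hl]
    · rw [if_neg (by omega), if_pos h, h']
      simp [hr]
    · rw [if_neg h, if_neg h']
      simp [hs h h', h₁]
  · rw [Units.val_neg, Units.val_one, zpow_neg_one, map_inv, hurwitz_gen, hurwitzStep_inv_apply,
      crossLabels, if_neg (show (-1 : ℤˣ) ≠ 1 by decide)]
    rcases hx with ⟨h, h'⟩ | ⟨h, h'⟩ | ⟨h, h', h₀, h₁⟩
    · rw [if_pos h, h']
      simp [hl]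
    · rw [if_neg (by omega), if_pos h, h']
      simp [hr]
    · rw [if_neg h, if_neg h']
      simp [hs h h', h₀]

/-- The labels after the first `k` of a sequence of crossings. -/
def runLabels {X : Type*} [DecidableEq X] {N : ℕ} (ε : Fin N → ℤˣ) (l r : Fin N → X)
    (v : X → G) : ℕ → X → G
  | 0 => v
  | k + 1 => if h : k < N then crossLabels (ε ⟨k, h⟩) (l ⟨k, h⟩) (r ⟨k, h⟩)
      (runLabels ε l r v k) else runLabels ε l r v k

theorem runLabels_succ {X : Type*} [DecidableEq X] {N : ℕ} (ε : Fin N → ℤˣ) (l r : Fin N → X)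
    (v : X → G) (k : Fin N) : runLabels ε l r v (k + 1) =
      crossLabels (ε k) (l k) (r k) (runLabels ε l r v k) := by
  rw [runLabels, dif_pos k.2]

/-- In a left action the last letter of a product acts first. The inverse is used so that the
letters act in the order of the word, at the price of opposite signs. -/
theorem hurwitz_prod_inv_comp {n N : ℕ} (f : Fin N → Fin (n - 1)) (ε : Fin N → ℤˣ)
    (u : Equiv.Perm (Fin n)) (l r : Fin N → Fin n)
    (hl : ∀ k : Fin N, (u * ((List.ofFn fun l => adjSwap (f l)).take k).prod) ⟨f k, by omega⟩ =
      l k)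
    (hr : ∀ k : Fin N, (u * ((List.ofFn fun l => adjSwap (f l)).take k).prod)
      ⟨f k + 1, by omega⟩ = r k) (v : Fin n → G) :
    hurwitz G n (List.ofFn fun k => gen (f k) ^ (ε k : ℤ)).prod⁻¹ (v ∘ u) =
      runLabels (fun k => -ε k) l r v N ∘ (u * (List.ofFn fun l => adjSwap (f l)).prod) := by
  have key : ∀ k ≤ N,
      hurwitz G n ((List.ofFn fun k => gen (f k) ^ (ε k : ℤ)).take k).prod⁻¹ (v ∘ u) =
        runLabels (fun k => -ε k) l r v k ∘
          (u * ((List.ofFn fun l => adjSwap (f l)).take k).prod) := by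
    intro k hk
    induction k with
    | zero => simp [runLabels]
    | succ k ih =>
      have e₁ := ofFn_take_succ_prod (fun k => gen (f k) ^ (ε k : ℤ)) ⟨k, hk⟩
      have e₂ := ofFn_take_succ_prod (fun l => adjSwap (f l)) ⟨k, hk⟩
      have e₃ := runLabels_succ (fun k => -ε k) l r v ⟨k, hk⟩
      have e₄ := hurwitz_gen_zpow_comp (f ⟨k, hk⟩) (-ε ⟨k, hk⟩) (runLabels (fun k => -ε k) l r v k)
        (u * ((List.ofFn fun l => adjSwap (f l)).take k).prod)
      rw [hl ⟨k, hk⟩, hr ⟨k, hk⟩, Units.val_neg, zpow_neg] at e₄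
      simp only at e₁ e₂ e₃
      rw [e₁, e₂, e₃, mul_inv_rev, map_mul, Equiv.Perm.mul_apply, ih (by omega), e₄, mul_assoc]
  have := key N le_rfl
  rwa [ofFn_take_prod, ofFn_take_prod] at this

variable {X : Type*} [DecidableEq X]

/-- Conjugating by `1`, or conjugating `1`, does nothing: strands labelled `1` may be deleted. -/
theorem crossLabels_of_eq_one (ε : ℤˣ) {l r : X} {v : X → G} (h : v l = 1 ∨ v r = 1) :
    crossLabels ε l r v = v := by
  rw [crossLabels]
  rcases h with h | h <;> split_ifs <;> simp [h]

theorem crossLabels_apply_eq_one (ε : ℤˣ) (l r : X) {v : X → G} {x : X} (h : v x = 1) :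
    crossLabels ε l r v x = 1 := by
  rw [crossLabels]
  split_ifs <;> rw [Function.update_apply] <;> split_ifs with hx
  · rw [← hx, h]; simp
  · exact h
  · rw [← hx, h]; simp
  · exact h

theorem crossLabels_comp {Y : Type*} [DecidableEq Y] {f : Y → X} (hf : Function.Injective f)
    (ε : ℤˣ) (l r : Y) (v : X → G) :
    crossLabels ε (f l) (f r) v ∘ f = crossLabels ε l r (v ∘ f) := by
  rw [crossLabels, crossLabels]
  split_ifs <;> exact Function.update_comp_eq_of_injective _ hf _ _

variable {N : ℕ} {ε : Fin N → ℤˣ} {l r : Fin N → X} {v : X → G}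

theorem runLabels_eq_one {x : X} (h : v x = 1) (k : ℕ) : runLabels ε l r v k x = 1 := by
  induction k with
  | zero => exact h
  | succ k ih =>
    rw [runLabels]
    split_ifs
    · exact crossLabels_apply_eq_one _ _ _ ih
    · exact ih

theorem runLabels_eq_of_le {a b : ℕ} (hab : a ≤ b) (hb : b ≤ N)
    (h : ∀ k : Fin N, a ≤ k → (k : ℕ) < b → v (l k) = 1 ∨ v (r k) = 1) :
    runLabels ε l r v b = runLabels ε l r v a := by
  induction b, hab using Nat.le_induction with
  | base => rfl
  | succ b hab ih =>
    have := runLabels_succ ε l r v ⟨b, hb⟩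
    simp only at this
    rw [this, crossLabels_of_eq_one, ih (by omega) fun k h₁ h₂ => h k h₁ (by omega)]
    exact (h ⟨b, hb⟩ hab (by simp)).imp (fun h => runLabels_eq_one h _)
      fun h => runLabels_eq_one h _

/-- If all crossings but three involve a strand with a trivial label, only these three
matter. -/
theorem runLabels_of_three {s t u : Fin N} (hst : s < t) (htu : t < u)
    (h : ∀ k : Fin N, k ≠ s → k ≠ t → k ≠ u → v (l k) = 1 ∨ v (r k) = 1) :
    runLabels ε l r v N = crossLabels (ε u) (l u) (r u) (crossLabels (ε t) (l t) (r t)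
      (crossLabels (ε s) (l s) (r s) v)) := by
  rw [runLabels_eq_of_le (a := u + 1) u.2 le_rfl, runLabels_succ,
    runLabels_eq_of_le (a := t + 1) htu u.2.le, runLabels_succ,
    runLabels_eq_of_le (a := s + 1) hst t.2.le, runLabels_succ,
    runLabels_eq_of_le (a := 0) (Nat.zero_le _) s.2.le, runLabels]
  all_goals
    intro k h₁ h₂
    refine h k ?_ ?_ ?_ <;> rintro rfl <;> omega

end Labels


/-! ### Cyclic triples of strands -/

set_option maxRecDepth 4000 in
-- The two statements are the two possible orders of the three crossings. Labels in an abelian group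
-- would never change; `𝔖₃` is the smallest group that can work.
theorem crossLabels_borromean (ε : ℤˣ) :
    let v : Fin 3 → Equiv.Perm (Fin 3) := ![Equiv.swap 1 2, Equiv.swap 1 2, Equiv.swap 0 1]
    crossLabels ε 2 1 (crossLabels (-ε) 2 0 (crossLabels ε 1 0
        (crossLabels (-ε) 1 2 (crossLabels ε 0 2 (crossLabels (-ε) 0 1 v))))) ≠ v ∧
      crossLabels ε 1 0 (crossLabels (-ε) 2 0 (crossLabels ε 2 1
        (crossLabels (-ε) 0 1 (crossLabels ε 0 2 (crossLabels (-ε) 1 2 v))))) ≠ v := by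
  rcases Int.units_eq_one_or ε with rfl | rfl <;> decide

/-- After the first half the strands are reversed, so a mirrored letter meets the same two particles
with left and right exchanged. Both halves thus run through the same crossings in the same order,
with opposite signs. -/
theorem runLabels_of_hurwitz_eq_one {G : Type*} [Group G] {n : ℕ} {S : SortingNetwork n}
    {σ : Signature n} (h : hurwitz G n (algebraicSortingBraid S σ) = 1) (v : Fin n → G) :
    runLabels σ S.rightParticle S.leftParticle
      (runLabels (fun k => -σ k) S.leftParticle S.rightParticle v (n.choose 2))
      (n.choose 2) = v := by
  have h₁ := hurwitz_prod_inv_comp S.word σ 1 S.leftParticle S.rightParticle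
    (fun k => by rw [one_mul]; rfl) (fun k => by rw [one_mul]; rfl) v
  have e : ∀ k : Fin (n.choose 2),
      Fin.revPerm * ((List.ofFn fun l => adjSwap (S.word l).rev).take k).prod =
        S.configuration k * Fin.revPerm := fun k => by
    rw [S.take_prod_adjSwap_rev k.2.le, mul_assoc, ← mul_assoc, revPerm_mul_revPerm, one_mul]
  have h₂ := hurwitz_prod_inv_comp (fun k => (S.word k).rev) (fun k => -σ k) Fin.revPerm
    S.rightParticle S.leftParticle
    (fun k => by
      have hk := (S.word k).2
      rw [e, Equiv.Perm.mul_apply, SortingNetwork.rightParticle]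
      congr 1
      ext
      simp only [Fin.revPerm_apply, Fin.val_rev]
      omega)
    (fun k => by
      have hk := (S.word k).2
      rw [e, Equiv.Perm.mul_apply, SortingNetwork.leftParticle]
      congr 1
      ext
      simp only [Fin.revPerm_apply, Fin.val_rev]
      omega)
    (runLabels (fun k => -σ k) S.leftParticle S.rightParticle v (n.choose 2))
  rw [S.prod_word, one_mul] at h₁
  rw [S.prod_adjSwap_rev, revPerm_mul_revPerm] at h₂
  simp only [neg_neg, Units.val_neg] at h₂
  have h₃ : hurwitz G n (algebraicSortingBraid S σ)⁻¹ v = v := by simp [h]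
  rw [algebraicSortingBraid, mul_inv_rev, map_mul, Equiv.Perm.mul_apply] at h₃
  rw [Equiv.Perm.coe_one, Function.comp_id] at h₁
  rw [h₁, h₂] at h₃
  simpa using h₃

theorem eq_of_hasTrivialClosure {n : ℕ} {S : SortingNetwork n} {σ : Signature n}
    (h : HasTrivialClosure (algebraicSortingBraid S σ)) {i j m : Fin n}
    {r s t : Fin (n.choose 2)} (hij : i < j) (hjm : j < m) (hr : S.Crosses r i j)
    (hs : S.Crosses s i m) (ht : S.Crosses t j m) (hrt : σ r = σ t) : σ s = σ r := by
  by_contra hsr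
  obtain ⟨ε, hεr, hεt, hεs⟩ : ∃ ε, σ r = ε ∧ σ t = ε ∧ σ s = -ε :=
    ⟨σ r, rfl, hrt.symm, Int.units_ne_iff_eq_neg.1 hsr⟩
  have him := hij.trans hjm
  let f : Fin 3 → Fin n := ![i, j, m]
  have hf : Function.Injective f := by
    intro a b hab
    fin_cases a <;> fin_cases b <;> simp [f] at hab ⊢ <;> omega
  let v₀ : Fin 3 → Equiv.Perm (Fin 3) := ![Equiv.swap 1 2, Equiv.swap 1 2, Equiv.swap 0 1]
  -- The default label `1` erases all strands other than `i`, `j`, `m`.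
  let v : Fin n → Equiv.Perm (Fin 3) := Function.extend f v₀ 1
  have hv : v ∘ f = v₀ := Function.extend_comp hf _ _
  have hv₁ : ∀ k : Fin (n.choose 2), k ≠ r → k ≠ s → k ≠ t →
      v (S.leftParticle k) = 1 ∨ v (S.rightParticle k) = 1 := by
    intro k hkr hks hkt
    by_contra! hk
    have hmem : ∀ x, v x ≠ 1 → x = i ∨ x = j ∨ x = m := by
      intro x hx
      by_contra! hne
      refine hx (Function.extend_apply' _ _ _ ?_)
      rintro ⟨a, rfl⟩
      fin_cases a <;> simp [f] at hne
    have hlt := S.leftParticle_lt_rightParticle k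
    have hc := S.crosses_self k
    rcases hmem _ hk.1 with hl | hl | hl <;> rcases hmem _ hk.2 with hr' | hr' | hr' <;>
      rw [hl, hr'] at hlt hc
    · exact lt_irrefl _ hlt
    · exact hkr (hc.unique hr)
    · exact hks (hc.unique hs)
    · exact lt_asymm hlt hij
    · exact lt_irrefl _ hlt
    · exact hkt (hc.unique ht)
    · exact lt_asymm hlt him
    · exact lt_asymm hlt hjm
    · exact lt_irrefl _ hlt
  have hfix := runLabels_of_hurwitz_eq_one
    (hurwitz_eq_one_of_hasTrivialClosure (G := Equiv.Perm (Fin 3)) h) v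
  obtain ⟨hr₀, hr₁⟩ := hr.eq_left_right hij
  obtain ⟨hs₀, hs₁⟩ := hs.eq_left_right him
  obtain ⟨ht₀, ht₁⟩ := ht.eq_left_right hjm
  -- Trivial labels survive the first half, so the same three crossings are the only ones that
  -- matter in the second.
  have hv₂ : ∀ k : Fin (n.choose 2), k ≠ r → k ≠ s → k ≠ t →
      runLabels (fun k => -σ k) S.leftParticle S.rightParticle v (n.choose 2)
        (S.rightParticle k) = 1 ∨
      runLabels (fun k => -σ k) S.leftParticle S.rightParticle v (n.choose 2)
        (S.leftParticle k) = 1 := fun k h₁ h₂ h₃ =>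
    (hv₁ k h₁ h₂ h₃).symm.imp (fun h => runLabels_eq_one h _) fun h => runLabels_eq_one h _
  have hi : i = f 0 := rfl
  have hj : j = f 1 := rfl
  have hm : m = f 2 := rfl
  have hb := crossLabels_borromean ε
  rcases hr.lt_lt_or_lt_lt hij hjm hs ht with ⟨h₁, h₂⟩ | ⟨h₁, h₂⟩
  · rw [runLabels_of_three h₁ h₂ hv₂, runLabels_of_three h₁ h₂ hv₁] at hfix
    have := congrArg (· ∘ f) hfix
    simp only [hr₀, hr₁, hs₀, hs₁, ht₀, ht₁, hi, hj, hm, crossLabels_comp hf, hv, hεr, hεs, hεt,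
      neg_neg] at this
    exact hb.1 this
  · rw [runLabels_of_three h₁ h₂ fun k a b c => hv₂ k c b a,
      runLabels_of_three h₁ h₂ fun k a b c => hv₁ k c b a] at hfix
    have := congrArg (· ∘ f) hfix
    simp only [hr₀, hr₁, hs₀, hs₁, ht₀, ht₁, hi, hj, hm, crossLabels_comp hf, hv, hεr, hεs, hεt,
      neg_neg] at this
    exact hb.2 this

/-! ### The two characterizations -/

theorem hasTrivialClosure_iff {n : ℕ} (S : SortingNetwork n) (σ : Signature n) :
    HasTrivialClosure (algebraicSortingBraid S σ) ↔
      ∃ p : Equiv.Perm (Fin n), IsInversionSet S σ p := by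
  refine ⟨fun h => ?_, fun ⟨p, hp⟩ => ?_⟩
  · rw [exists_isInversionSet_iff_exists_order]
    exact exists_order_of_triples S σ fun i j m r s t hij hjm hr hs ht =>
      eq_of_hasTrivialClosure h hij hjm hr hs ht
  · rw [algebraicSortingBraid_eq_one hp]
    exact Relation.EqvGen.refl _

theorem algebraicSortingBraid_eq_one_iff {n : ℕ} (S : SortingNetwork n) (σ : Signature n) :
    algebraicSortingBraid S σ = 1 ↔ ∃ p : Equiv.Perm (Fin n), IsInversionSet S σ p := by
  refine ⟨fun h => (hasTrivialClosure_iff S σ).1 ?_, fun ⟨p, hp⟩ =>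
    algebraicSortingBraid_eq_one hp⟩
  rw [h]
  exact Relation.EqvGen.refl _

end SortingBraid

theorem mainTheorem2 (n : ℕ) (S : SortingBraid.SortingNetwork n) :
    -- there are `2 ^ N` signatures, of which exactly `n!` give a trivial braid
    Nat.card (SortingBraid.Signature n) = 2 ^ n.choose 2 ∧
    Nat.card {σ : SortingBraid.Signature n //
      SortingBraid.algebraicSortingBraid S σ = 1} = Nat.factorial n ∧
    -- and exactly `n!` give a braid whose closure is a trivial link
    Nat.card {σ : SortingBraid.Signature n //
      SortingBraid.HasTrivialClosure (SortingBraid.algebraicSortingBraid S σ)} =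
        Nat.factorial n ∧
    -- in both cases these are the signatures that are inversion sets of permutations
    (∀ σ : SortingBraid.Signature n, SortingBraid.algebraicSortingBraid S σ = 1 ↔
      ∃ p : Equiv.Perm (Fin n), SortingBraid.IsInversionSet S σ p) ∧
    (∀ σ : SortingBraid.Signature n,
      SortingBraid.HasTrivialClosure (SortingBraid.algebraicSortingBraid S σ) ↔
        ∃ p : Equiv.Perm (Fin n), SortingBraid.IsInversionSet S σ p) ∧
    -- equivalently, the signatures that come from total orders on the strands
    (∀ σ : SortingBraid.Signature n,
      (∃ p : Equiv.Perm (Fin n), SortingBraid.IsInversionSet S σ p) ↔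
        ∃ r : Fin n → Fin n → Prop, IsStrictTotalOrder (Fin n) r ∧
          SortingBraid.ComesFromOrder S σ r) := by
  refine ⟨by simp [Nat.card_eq_fintype_card], ?_, ?_,
    SortingBraid.algebraicSortingBraid_eq_one_iff S,
    SortingBraid.hasTrivialClosure_iff S, SortingBraid.exists_isInversionSet_iff_exists_order S⟩
  · simp only [SortingBraid.algebraicSortingBraid_eq_one_iff]
    exact SortingBraid.card_inversionSets S
  · simp only [SortingBraid.hasTrivialClosure_iff]
    exact SortingBraid.card_inversionSets S
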